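/- **Theorem 5.3.** Let $s\in[0,1]$, and let $p,q\in[0,1)$ and $r\in(0,1)$ satisfy $p+q+r=1$; put $\alpha=p-q$ and $\beta=1-r$, so that $\beta\in(0,1)$ and $\alpha\in[-\beta,\beta]$. Let $(m_n)_{n\ge1}$ be integers with $1\le m_n\le n$ for all $n\geq 1$, $m_n\to\infty$, and $\gamma_n:=m_n/n\to\gamma$ for some $\gamma\in[0,1]$. The ERW with stops in the triangular array setting is defined as follows. Let $X_1$ be $+1$ with probability $s$ and $-1$ with probability $1-s$, and for $n\ge1$ let $X_{n+1}=\varepsilon_nX_{U_n}$, where $U_n$ is uniform on $\{1,\dots,n\}$ and $\varepsilon_n$ takes the values $+1,-1,0$ with probabilities $p,q,r$. For $n\ge1$ and $m_n<k\le n$ let $X^{(n)}_k=\varepsilon_{k,n}X_{U_{k,n}}$, where $U_{k,n}$ is uniform on $\{1,\dots,m_n\}$ and $\varepsilon_{k,n}$ takes the values $+1,-1,0$ with probabilities $p,q,r$. All the random variables $X_1$, $U_n$, $\varepsilon_n$ ($n\ge1$), $U_{k,n}$, $\varepsilon_{k,n}$ ($n\geq 1$, $m_n<k\le n$) are mutually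 independent and defined on one probability space. Set $$T_n:=\sum_{k=1}^{m_n}X_k+\sum_{k=m_n+1}^{n}X^{(n)}_k .$$ Then $$\lim_{n\to\infty}\frac{T_n}{n}=0\quad\text{almost surely.}$$ Moreover, for every $c\in(\max\{\alpha,1/2\},1)$, $$\lim_{n\to\infty}\frac{\gamma_nT_n}{(m_n)^c}=0\quad\text{almost surely.}$$ -/

import Mathlib

open MeasureTheory ProbabilityTheory Filter Topology

/-- The random inputs of the elephant random walk (ERW) with stops in the triangular array setting:
the first step `X₁`; the memories `U n` and coins `coin n` used to produce `X_{n+1}`; and, in the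
`n`-th row of the array, the memories `arrU n k` and coins `arrCoin n k` used to produce
`X^{(n)}_k`. A coin is `1` (repeat), `-1` (reverse) or `0` (stop). -/
structure ERWInputs (Ω : Type*) where
  first : Ω → ℤ
  U : ℕ → Ω → ℕ
  coin : ℕ → Ω → ℤ
  arrU : ℕ → ℕ → Ω → ℕ
  arrCoin : ℕ → ℕ → Ω → ℤ

/-- The labels of the inputs that are used: `U n` and `coin n` for `n ≥ 1`, and
`arrU n k` and `arrCoin n k` for `m n < k ≤ n`. -/
inductive ERWLabel (m : ℕ → ℕ) where
  | first : ERWLabel m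
  | U (n : ℕ) (hn : 1 ≤ n) : ERWLabel m
  | coin (n : ℕ) (hn : 1 ≤ n) : ERWLabel m
  | arrU (n k : ℕ) (hk : m n < k ∧ k ≤ n) : ERWLabel m
  | arrCoin (n k : ℕ) (hk : m n < k ∧ k ≤ n) : ERWLabel m

/-- `V` is uniformly distributed over `{1, …, N}`. -/
structure IsUniformUpTo {Ω : Type*} [MeasurableSpace Ω] (μ : Measure Ω) (N : ℕ) (V : Ω → ℕ) :
    Prop where
  measurable : Measurable V
  prob : ∀ j ∈ Finset.Icc 1 N, μ.real {ω | V ω = j} = 1 / (N : ℝ)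

/-- `ε` is `1` with probability `p`, `-1` with probability `q`, and `0` with probability `r`. -/
structure IsStepCoin {Ω : Type*} [MeasurableSpace Ω] (μ : Measure Ω) (p q r : ℝ) (ε : Ω → ℤ) :
    Prop where
  measurable : Measurable ε
  prob_one : μ.real {ω | ε ω = 1} = p
  prob_neg_one : μ.real {ω | ε ω = -1} = q
  prob_zero : μ.real {ω | ε ω = 0} = r

namespace ERWInputs

/-- All the used inputs as one family (memories are read as integers). -/
def family {Ω : Type*} (m : ℕ → ℕ) (I : ERWInputs Ω) : ERWLabel m → Ω → ℤ
  | .first => I.first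
  | .U n _ => fun ω => (I.U n ω : ℤ)
  | .coin n _ => I.coin n
  | .arrU n k _ => fun ω => (I.arrU n k ω : ℤ)
  | .arrCoin n k _ => I.arrCoin n k

/-- The law of the inputs: the first step is `1` with probability `s` and `-1` with probability
`1 - s`, `U n` is uniform over `{1, …, n}`, `arrU n k` is uniform over `{1, …, m n}`, each coin
is `1`, `-1`, `0` with probabilities `p`, `q`, `r`, and all inputs are mutually independent. -/
structure HasERWLaw {Ω : Type*} [MeasurableSpace Ω] (μ : Measure Ω) (m : ℕ → ℕ) (s p q r : ℝ)
    (I : ERWInputs Ω) : Prop where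
  measurable_first : Measurable I.first
  first_one : μ.real {ω | I.first ω = 1} = s
  first_neg_one : μ.real {ω | I.first ω = -1} = 1 - s
  uniform_U : ∀ n, 1 ≤ n → IsUniformUpTo μ n (I.U n)
  coin_law : ∀ n, 1 ≤ n → IsStepCoin μ p q r (I.coin n)
  uniform_arrU : ∀ n k, m n < k → k ≤ n → IsUniformUpTo μ (m n) (I.arrU n k)
  arrCoin_law : ∀ n k, m n < k → k ≤ n → IsStepCoin μ p q r (I.arrCoin n k)
  indep : iIndepFun (I.family m) μ

/-- The steps `X_1, X_2, …` of the ERW with stops: `X_{n+1}` is `X_{U_n}`, `-X_{U_n}` or `0`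
according to the `n`-th coin. (`X_0 = 0` is a placeholder, and the value when `U_n` lies outside
`{1, …, n}`, an event of probability zero, is set to `0`.) -/
def X {Ω : Type*} (I : ERWInputs Ω) : ℕ → Ω → ℤ
  | 0, _ => 0
  | 1, ω => I.first ω
  | n + 2, ω =>
      I.coin (n + 1) ω * (if _h : I.U (n + 1) ω < n + 2 then I.X (I.U (n + 1) ω) ω else 0)
termination_by n => n

/-- The steps `X^{(n)}_k` (used for `m n < k ≤ n`) of the `n`-th row of the array. -/
def arrX {Ω : Type*} (I : ERWInputs Ω) (n k : ℕ) (ω : Ω) : ℤ :=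
  I.arrCoin n k ω * I.X (I.arrU n k ω) ω

/-- The steps `Y^{(n)}_k`, `1 ≤ k ≤ n`, of the `n`-th row: the original ERW steps up to time `m n`,
and from then on the steps `X^{(n)}_k`, whose memory is restricted to `{1, …, m n}`. -/
def Y {Ω : Type*} (m : ℕ → ℕ) (I : ERWInputs Ω) (n k : ℕ) (ω : Ω) : ℤ :=
  if k ≤ m n then I.X k ω else I.arrX n k ω

/-- `S^{(n)}_k = Y^{(n)}_1 + … + Y^{(n)}_k`. -/
def S {Ω : Type*} (m : ℕ → ℕ) (I : ERWInputs Ω) (n k : ℕ) (ω : Ω) : ℤ :=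
  ∑ i ∈ Finset.Icc 1 k, I.Y m n i ω

/-- `T_n = S^{(n)}_n`: the ERW with stops in the triangular array setting. -/
def T {Ω : Type*} (m : ℕ → ℕ) (I : ERWInputs Ω) (n : ℕ) (ω : Ω) : ℤ :=
  I.S m n n ω

end ERWInputs

/-! Write a = p - q, W_n for `walk` and R_n for `rowNoise` of the full n-th row. Given the past,
X_{n+1} almost surely lies in [-1, 1] and has mean a W_n / n, so Hoeffding's lemma gives E exp(l
W_{n+1}) ≤ exp(4 l²) E exp(l (1 + a/n) W_n). Iterating over n (`lintegral_exp_walk_succ_le`) leads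
to a subgaussian bound whose variance proxy solves v_{n+1} = (1 + a/n)² v_n + 4. Hence v_n = O(n^b)
for every b > max(1, 2a) (`exists_forall_le_mul_rpow`), and Chernoff with Borel–Cantelli gives W_n /
n^c → 0 whenever c > max(a, 1/2).

In a row, the steps after m_n have conditional mean a W_{m_n} / m_n given the walk; the same
estimate makes R_n subgaussian with proxy O(n), so R_n / n^c → 0. Borel–Cantelli needs no relation
between rows. Finally T_n = W_{m_n} + (n - m_n) a W_{m_n} / m_n + R_n, and since c < 1 both
contributions to γ_n T_n / m_n^c vanish. The law of large numbers follows because m_n^(1-c) ≥ 1. -/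

/-! ### Exponential inequalities -/

/-- For a centred variable the linear term averages out, leaving only the exponential of the square.
-/
lemma Real.exp_le_self_add_exp_sq (y : ℝ) : Real.exp y ≤ y + Real.exp (y ^ 2) := by
  have h2 := Real.add_one_le_exp (y ^ 2)
  rcases le_or_gt |y| 1 with h | h
  · have h1 := (abs_le.1 (Real.abs_exp_sub_one_sub_id_le h)).2
    linarith
  · rcases lt_abs.1 h with h | h
    · have : Real.exp y ≤ Real.exp (y ^ 2) := Real.exp_le_exp.2 (by nlinarith)
      linarith
    · have : Real.exp y ≤ 1 := Real.exp_le_one_iff.2 (by linarith)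
      nlinarith

/-- A form of Hoeffding's lemma for finitely supported laws on `[-1, 1]`. -/
lemma Finset.sum_mul_exp_le {ι : Type*} (s : Finset ι) (w x : ι → ℝ) (hw : ∀ i ∈ s, 0 ≤ w i)
    (hw1 : ∑ i ∈ s, w i = 1) (hx : ∀ i ∈ s, |x i| ≤ 1) (l : ℝ) :
    ∑ i ∈ s, w i * Real.exp (l * x i) ≤
      Real.exp (l * ∑ i ∈ s, w i * x i + 4 * l ^ 2) := by
  set a := ∑ i ∈ s, w i * x i with ha
  have ha1 : |a| ≤ 1 := by
    calc |a| ≤ ∑ i ∈ s, |w i * x i| := Finset.abs_sum_le_sum_abs _ _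
      _ ≤ ∑ i ∈ s, w i := Finset.sum_le_sum fun i hi => by
          rw [abs_mul, abs_of_nonneg (hw i hi)]
          exact mul_le_of_le_one_right (hw i hi) (hx i hi)
      _ = 1 := hw1
  have key : ∀ i ∈ s, w i * Real.exp (l * x i) ≤
      Real.exp (l * a) * (w i * (l * (x i - a)) + w i * Real.exp (4 * l ^ 2)) := fun i hi => by
    have h1 : Real.exp (l * x i) = Real.exp (l * a) * Real.exp (l * (x i - a)) := by
      rw [← Real.exp_add]; ring_nf
    have h2 : (l * (x i - a)) ^ 2 ≤ 4 * l ^ 2 := by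
      have h3 : (x i - a) ^ 2 ≤ 4 := by
        have := abs_le.1 ha1
        have := abs_le.1 (hx i hi)
        nlinarith
      rw [mul_pow]; nlinarith [sq_nonneg l]
    have h3 := (Real.exp_le_self_add_exp_sq (l * (x i - a))).trans
      (add_le_add_right (Real.exp_le_exp.2 h2) _)
    rw [h1, ← mul_add]
    calc _ = Real.exp (l * a) * (w i * Real.exp (l * (x i - a))) := by ring
      _ ≤ _ := by gcongr; exact hw i hi
  refine (Finset.sum_le_sum key).trans_eq ?_
  rw [← Finset.mul_sum, Finset.sum_add_distrib, ← Finset.sum_mul, hw1, Real.exp_add]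
  have : ∑ i ∈ s, w i * (l * (x i - a)) = 0 := by
    have h : ∀ i ∈ s, w i * (l * (x i - a)) = l * (w i * x i) - l * a * w i := fun i _ => by ring
    rw [Finset.sum_congr rfl h, Finset.sum_sub_distrib, ← Finset.mul_sum, ← Finset.mul_sum, hw1]
    simp [ha]
  rw [this]; ring

/-! ### Exponential moment of one step -/

section Step
variable {Ω : Type*} {F G : MeasurableSpace Ω} [mΩ : MeasurableSpace Ω] {μ : Measure Ω} [IsProbabilityMeasure μ]

lemma ae_mem_finset_of_sum_measureReal {β : Type*} [MeasurableSpace β] [MeasurableSingletonClass β]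
    [DecidableEq β] {V : Ω → β} (hV : Measurable V) (s : Finset β)
    (hs : ∑ j ∈ s, μ.real {ω | V ω = j} = 1) : ∀ᵐ ω ∂μ, V ω ∈ s := by
  have h : μ.real (V ⁻¹' s) = 1 := by
    rw [← hs]
    have : V ⁻¹' s = ⋃ j ∈ s, {ω | V ω = j} := by ext; simp
    rw [this, measureReal_biUnion_finset]
    · intro i _ j _ hij
      rw [Function.onFun, Set.disjoint_left]
      intro ω h1 h2
      exact hij (h1.symm.trans h2)
    · intro j _
      exact hV (measurableSet_singleton j)
  have h' : μ (V ⁻¹' s) = 1 := by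
    rw [measureReal_def] at h
    rw [← ENNReal.ofReal_toReal (measure_ne_top μ (V ⁻¹' s)), h, ENNReal.ofReal_one]
  exact (mem_ae_iff_prob_eq_one (hV s.measurableSet)).2 h'

lemma IsUniformUpTo.ae_mem {N : ℕ} {V : Ω → ℕ} (hN : 1 ≤ N) (hV : IsUniformUpTo μ N V) :
    ∀ᵐ ω ∂μ, V ω ∈ Finset.Icc 1 N := by
  refine ae_mem_finset_of_sum_measureReal hV.measurable _ ?_
  rw [Finset.sum_congr rfl hV.prob]
  have : (N : ℝ) ≠ 0 := by positivity
  simp [this]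

lemma IsStepCoin.ae_mem {p q r : ℝ} {ε : Ω → ℤ} (hpqr : p + q + r = 1)
    (hε : IsStepCoin μ p q r ε) : ∀ᵐ ω ∂μ, ε ω ∈ ({1, -1, 0} : Finset ℤ) := by
  refine ae_mem_finset_of_sum_measureReal hε.measurable _ ?_
  simp [hε.prob_one, hε.prob_neg_one, hε.prob_zero, ← hpqr, add_assoc]

/-- The exponential moment of one step of the walk, given a past `F` independent of the memory `V`
and of the coin `ε` used in that step. -/
lemma lintegral_mul_exp_step_le {p q r : ℝ} (hpqr : p + q + r = 1) {N : ℕ} (hN : 1 ≤ N)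
    {V : Ω → ℕ} {ε : Ω → ℤ} (hV : IsUniformUpTo μ N V) (hε : IsStepCoin μ p q r ε)
    (hVε : IndepFun V ε μ) (hF : F ≤ mΩ) (hG : G ≤ mΩ)
    (hind : Indep G F μ) (hVG : Measurable[G] V) (hεG : Measurable[G] ε)
    {x : ℕ → Ω → ℤ} (hx : ∀ j, Measurable[F] (x j)) (hxb : ∀ᵐ ω ∂μ, ∀ j, |x j ω| ≤ 1)
    {g : Ω → ENNReal} (hg : Measurable[F] g) (l : ℝ) :
    ∫⁻ ω, g ω * ENNReal.ofReal (Real.exp (l * (ε ω * x (V ω) ω : ℤ))) ∂μ ≤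
      ∫⁻ ω, g ω * ENNReal.ofReal (Real.exp
        (l * ((p - q) * (∑ j ∈ Finset.Icc 1 N, x j ω : ℤ) / N) + 4 * l ^ 2)) ∂μ := by
  classical
  let s : Finset (ℕ × ℤ) := Finset.Icc 1 N ×ˢ {1, -1, 0}
  let w : ℕ × ℤ → ℝ := fun i => 1 / (N : ℝ) * μ.real {ω | ε ω = i.2}
  let A : ℕ × ℤ → Set Ω := fun i => V ⁻¹' {i.1} ∩ ε ⁻¹' {i.2}
  let h : ℕ × ℤ → Ω → ENNReal := fun i ω =>
    g ω * ENNReal.ofReal (Real.exp (l * (i.2 * x i.1 ω : ℤ)))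
  have hN0 : (N : ℝ) ≠ 0 := by positivity
  have hh : ∀ i, Measurable[F] (h i) := fun i => by
    have h1 : Measurable (fun z : ℤ => ENNReal.ofReal (Real.exp (l * (i.2 * z : ℤ)))) :=
      measurable_of_countable _
    exact hg.mul (h1.comp (hx i.1))
  have hAG : ∀ i, MeasurableSet[G] (A i) := fun i =>
    (hVG (measurableSet_singleton _)).inter (hεG (measurableSet_singleton _))
  have hA : ∀ i ∈ s, μ (A i) = ENNReal.ofReal (w i) := fun i hi => by
    have hi1 : i.1 ∈ Finset.Icc 1 N := (Finset.mem_product.1 hi).1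
    have := hVε.measure_inter_preimage_eq_mul {i.1} {i.2} (measurableSet_singleton _)
      (measurableSet_singleton _)
    rw [show A i = V ⁻¹' {i.1} ∩ ε ⁻¹' {i.2} from rfl, this, ENNReal.ofReal_mul (by positivity),
      ← hV.prob i.1 hi1, ofReal_measureReal, ofReal_measureReal]
    rfl
  -- Split over the finitely many values of (V, ε): each indicator is `G`-measurable and its
  -- cofactor `F`-measurable, so independence factors every integral.
  have hstart : ∫⁻ ω, g ω * ENNReal.ofReal (Real.exp (l * (ε ω * x (V ω) ω : ℤ))) ∂μ =
      ∫⁻ ω, ∑ i ∈ s, (A i).indicator 1 ω * h i ω ∂μ := by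
    refine lintegral_congr_ae ?_
    filter_upwards [hV.ae_mem hN, hε.ae_mem hpqr] with ω h1 h2
    rw [Finset.sum_eq_single (V ω, ε ω)]
    · simp [A, h]
    · intro i _ hne
      rw [Set.indicator_of_notMem, zero_mul]
      rintro ⟨h3, h4⟩
      exact hne (Prod.ext (by simpa using h3.symm) (by simpa using h4.symm))
    · intro h3
      exact absurd (Finset.mem_product.2 ⟨h1, h2⟩) h3
  have hmeas : ∀ i, Measurable[G] ((A i).indicator (1 : Ω → ENNReal)) := fun i =>
    (@measurable_const _ _ _ G 1).indicator (hAG i)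
  have hprod : ∀ i, Measurable fun ω => (A i).indicator 1 ω * h i ω := fun i =>
    ((hmeas i).mono hG le_rfl).mul ((hh i).mono hF le_rfl)
  rw [hstart, lintegral_finsetSum _ fun i _ => hprod i]
  have hterm : ∀ i ∈ s, ∫⁻ ω, (A i).indicator 1 ω * h i ω ∂μ =
      ∫⁻ ω, ENNReal.ofReal (w i) * h i ω ∂μ := fun i hi => by
    rw [lintegral_mul_eq_lintegral_mul_lintegral_of_independent_measurableSpace hG hF hind
      (hmeas i) (hh i), lintegral_indicator_one (hG _ (hAG i)), hA i hi,
      lintegral_const_mul _ ((hh i).mono hF le_rfl)]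
  rw [Finset.sum_congr rfl hterm, ← lintegral_finsetSum _ fun i _ =>
    ((hh i).mono hF le_rfl).const_mul _]
  refine lintegral_mono_ae ?_
  filter_upwards [hxb] with ω hω
  have hw0 : ∀ i ∈ s, 0 ≤ w i := fun i _ => by positivity
  have hw1 : ∑ i ∈ s, w i = 1 := by
    simp only [s, w, Finset.sum_product, ← Finset.mul_sum]
    simp [hε.prob_one, hε.prob_neg_one, hε.prob_zero]
    field_simp
    linarith
  have hwx : ∑ i ∈ s, w i * ((i.2 * x i.1 ω : ℤ) : ℝ) =
      (p - q) * (∑ j ∈ Finset.Icc 1 N, x j ω : ℤ) / N := by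
    simp only [s, w, Finset.sum_product]
    simp [hε.prob_one, hε.prob_neg_one, hε.prob_zero]
    rw [Finset.mul_sum, Finset.sum_div]
    refine Finset.sum_congr rfl fun j _ => ?_
    field_simp
    ring
  have hb : ∀ i ∈ s, |((i.2 * x i.1 ω : ℤ) : ℝ)| ≤ 1 := fun i hi => by
    have h2 : |i.2| ≤ 1 := by
      have := (Finset.mem_product.1 hi).2
      simp only [Finset.mem_insert, Finset.mem_singleton] at this
      rcases this with h | h | h <;> simp [h]
    rw [← Int.cast_abs, abs_mul]
    exact_mod_cast mul_le_one₀ h2 (abs_nonneg _) (hω i.1)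
  have := Finset.sum_mul_exp_le s w _ hw0 hw1 hb l
  rw [hwx] at this
  calc ∑ i ∈ s, ENNReal.ofReal (w i) * h i ω
      = g ω * ∑ i ∈ s, ENNReal.ofReal (w i * Real.exp (l * (i.2 * x i.1 ω : ℤ))) := by
        rw [Finset.mul_sum]
        refine Finset.sum_congr rfl fun i hi => ?_
        rw [ENNReal.ofReal_mul (hw0 i hi)]
        simp only [h]; ring
    _ = g ω * ENNReal.ofReal (∑ i ∈ s, w i * Real.exp (l * (i.2 * x i.1 ω : ℤ))) := by
        rw [ENNReal.ofReal_sum_of_nonneg fun i hi => mul_nonneg (hw0 i hi) (Real.exp_nonneg _)]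
    _ ≤ _ := by gcongr

end Step

/-! ### Chernoff bounds and Borel–Cantelli -/

section BorelCantelli
variable {Ω : Type*} [mΩ : MeasurableSpace Ω] {μ : Measure Ω}

lemma summable_exp_neg_mul_rpow {k d : ℝ} (hk : 0 < k) (hd : 0 < d) :
    Summable fun n : ℕ => Real.exp (-k * (n : ℝ) ^ d) := by
  -- At t = n^d the comparison function t^(-2/d) is n^(-2).
  have h1 := (isLittleO_exp_neg_mul_rpow_atTop hk (-2 / d)).isBigO
  have h2 := h1.comp_tendsto ((tendsto_rpow_atTop hd).comp tendsto_natCast_atTop_atTop)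
  refine summable_of_isBigO_nat (Real.summable_nat_rpow.2 (show (-2 : ℝ) < -1 by norm_num))
    (h2.congr_right fun n => ?_)
  simp only [Function.comp_apply]
  rw [← Real.rpow_mul (Nat.cast_nonneg n)]
  congr 1; field_simp

/-- Taking l = ± n^(-b/2) in Chernoff's bound turns the quadratic term into the constant C; what
remains, exp(1 + C - e n^(c - b/2)), is summable because c > b/2. -/
lemma ae_tendsto_div_rpow_of_lintegral_exp_le {Z : ℕ → Ω → ℝ} (hZ : ∀ n, Measurable (Z n))
    {C b c : ℝ} (hbc : b < 2 * c)
    (h : ∀ n, 1 ≤ n → ∀ l : ℝ, ∫⁻ ω, ENNReal.ofReal (Real.exp (l * Z n ω)) ∂μ ≤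
      ENNReal.ofReal (Real.exp (1 + C * (n : ℝ) ^ b * l ^ 2))) :
    ∀ᵐ ω ∂μ, Tendsto (fun n : ℕ => Z n ω / (n : ℝ) ^ c) atTop (𝓝 0) := by
  have main : ∀ e : ℝ, 0 < e → ∀ᵐ ω ∂μ, ∀ᶠ n : ℕ in atTop, |Z n ω| < e * (n : ℝ) ^ c := by
    intro e he
    have tail : ∀ σ : ℝ, σ ^ 2 = 1 → ∀ᵐ ω ∂μ, ∀ᶠ n : ℕ in atTop, σ * Z n ω < e * (n : ℝ) ^ c := by
      intro σ hσ
      have hsum : ∑' n : ℕ, μ {ω | 1 ≤ n ∧ e * (n : ℝ) ^ c ≤ σ * Z n ω} ≠ ⊤ := by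
        have hs := (summable_exp_neg_mul_rpow he (show 0 < c - b / 2 by linarith)).mul_left
          (Real.exp (1 + C))
        refine ne_top_of_le_ne_top hs.tsum_ofReal_ne_top (ENNReal.tsum_le_tsum fun n => ?_)
        rcases Nat.eq_zero_or_pos n with rfl | hn
        · simp
        have hn0 : (0 : ℝ) < n := by exact_mod_cast hn
        set l : ℝ := (n : ℝ) ^ (-(b / 2)) with hl
        have hl0 : 0 < l := Real.rpow_pos_of_pos hn0 _
        have hl2 : (n : ℝ) ^ b * (σ * l) ^ 2 = 1 := by
          rw [mul_pow, hσ, one_mul, hl, ← Real.rpow_natCast, ← Real.rpow_mul hn0.le,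
            ← Real.rpow_add hn0]
          norm_num
        have hlc : (n : ℝ) ^ c * l = (n : ℝ) ^ (c - b / 2) := by
          rw [hl, ← Real.rpow_add hn0]; ring_nf
        have hmark := meas_ge_le_lintegral_div (μ := μ)
          (f := fun ω => ENNReal.ofReal (Real.exp (σ * l * Z n ω)))
          (by have := hZ n; fun_prop)
          (ε := ENNReal.ofReal (Real.exp (l * (e * (n : ℝ) ^ c))))
          (by simpa using Real.exp_pos _) ENNReal.ofReal_ne_top
        refine (measure_mono ?_).trans (hmark.trans ((ENNReal.div_le_div_right (h n hn _) _).trans ?_))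
        · rintro ω ⟨_, hω⟩
          refine ENNReal.ofReal_le_ofReal (Real.exp_le_exp.2 ?_)
          calc _ ≤ l * (σ * Z n ω) := by gcongr
            _ = _ := by ring
        · rw [← ENNReal.ofReal_div_of_pos (Real.exp_pos _), ← Real.exp_sub, ← Real.exp_add]
          refine ENNReal.ofReal_le_ofReal (Real.exp_le_exp.2 (le_of_eq ?_))
          rw [mul_assoc C, hl2, ← hlc]; ring
      filter_upwards [ae_eventually_notMem hsum] with ω hω
      filter_upwards [hω, eventually_ge_atTop 1] with n h1 h2
      by_contra hcon
      exact h1 ⟨h2, not_lt.1 hcon⟩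
    filter_upwards [tail 1 (by norm_num), tail (-1) (by norm_num)] with ω h1 h2
    filter_upwards [h1, h2] with n h1 h2
    rw [abs_lt]; constructor <;> linarith
  have hall := ae_all_iff.2 fun k : ℕ => main (1 / ((k : ℝ) + 1)) (by positivity)
  filter_upwards [hall] with ω hω
  rw [Metric.tendsto_atTop']
  intro e he
  obtain ⟨k, hk⟩ := exists_nat_one_div_lt he
  obtain ⟨n0, hn0⟩ := eventually_atTop.1 (hω k)
  refine ⟨n0, fun n hn => ?_⟩
  have hpos : 0 < (n : ℝ) ^ c := Real.rpow_pos_of_pos (by exact_mod_cast (by omega : 0 < n)) _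
  rw [Real.dist_eq, sub_zero, abs_div, abs_of_pos hpos, div_lt_iff₀ hpos]
  exact (hn0 n hn.le).trans (by gcongr)

end BorelCantelli

/-! ### Growth of the variance recursion -/

/-- The solutions of the variance recursion of the walk grow at most like `n ^ b`. -/
lemma exists_forall_le_mul_rpow {a b : ℝ} (ha : |a| ≤ 1) (hb : 1 < b) (hab : 2 * a < b)
    {v : ℕ → ℝ} (hv : ∀ n : ℕ, 1 ≤ n → v (n + 1) ≤ (1 + a / n) ^ 2 * v n + 4) :
    ∃ C : ℝ, ∀ n : ℕ, 1 ≤ n → v n ≤ C * (n : ℝ) ^ b := by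
  obtain ⟨n0, hn0⟩ := exists_nat_gt (2 / (b - 2 * a))
  have hd : 0 < b - 2 * a := by linarith
  set n1 := n0 + 1
  -- The first summand absorbs the increment 4 in the induction; the second covers the initial range
  -- n ≤ n1.
  set C : ℝ := 8 / (b - 2 * a) + ∑ i ∈ Finset.Icc 1 n1, |v i| with hC
  have hsum0 : 0 ≤ ∑ i ∈ Finset.Icc 1 n1, |v i| := Finset.sum_nonneg fun _ _ => abs_nonneg _
  have hC1 : 8 ≤ C * (b - 2 * a) := by
    rw [hC, add_mul, div_mul_cancel₀ _ hd.ne']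
    nlinarith
  have hC0 : 0 ≤ C := by positivity
  have small : ∀ n : ℕ, 1 ≤ n → n ≤ n1 → v n ≤ C * (n : ℝ) ^ b := by
    intro n h1 h2
    have h3 : v n ≤ C := by
      have h4 := Finset.single_le_sum (f := fun i => |v i|) (fun i _ => abs_nonneg _)
        (Finset.mem_Icc.2 ⟨h1, h2⟩)
      have h5 : 0 ≤ 8 / (b - 2 * a) := by positivity
      have := le_abs_self (v n)
      linarith
    have h4 : (1 : ℝ) ≤ (n : ℝ) ^ b := Real.one_le_rpow (by exact_mod_cast h1) (by linarith)
    nlinarith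
  have large : ∀ n : ℕ, n1 ≤ n → v n ≤ C * (n : ℝ) ^ b := by
    intro n hn
    induction n, hn using Nat.le_induction with
    | base => exact small n1 (by omega) le_rfl
    | succ n hn ih =>
      have hn1 : 1 ≤ n := by omega
      have hnpos : (0 : ℝ) < n := by exact_mod_cast hn1
      have hbig : 2 / (b - 2 * a) < n := hn0.trans (by exact_mod_cast (by omega : n0 < n))
      rw [div_lt_iff₀ hd] at hbig
      set t : ℝ := 1 / n with ht
      have ht0 : 0 < t := by positivity
      have hnt : (n : ℝ) * t = 1 := by rw [ht]; field_simp
      set P : ℝ := (n : ℝ) ^ b with hP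
      have hP0 : 0 ≤ P := Real.rpow_nonneg hnpos.le _
      have hPt : 1 ≤ P * t := by
        have : P * t = (n : ℝ) ^ (b - 1) := by
          rw [hP, ht, Real.rpow_sub_one hnpos.ne']; ring
        rw [this]
        exact Real.one_le_rpow (by exact_mod_cast hn1) (by linarith)
      have hbern : P * (1 + b * t) ≤ ((n + 1 : ℕ) : ℝ) ^ b := by
        have h1 := one_add_mul_self_le_rpow_one_add (show -1 ≤ t by linarith) hb.le
        have h2 : ((n + 1 : ℕ) : ℝ) = n * (1 + t) := by push_cast; linarith
        rw [h2, Real.mul_rpow hnpos.le (by linarith)]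
        gcongr
      have hstep : v (n + 1) ≤ (1 + a * t) ^ 2 * (C * P) + 4 := by
        refine (hv n hn1).trans ?_
        have : a / n = a * t := by rw [ht]; ring
        rw [this]
        gcongr
      have ha2 : a ^ 2 ≤ 1 := (sq_le_one_iff_abs_le_one a).2 ha
      have ht2 : 2 * t ≤ b - 2 * a := by nlinarith
      -- Since a² ≤ 1 and t ≤ (b - 2a)/2, the square term costs only half of the gap (b - 2a) t. The
      -- other half, multiplied by C P, pays for the 4, as P t ≥ 1.
      have h1 : (1 + a * t) ^ 2 ≤ 1 + b * t - (b - 2 * a) / 2 * t := by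
        nlinarith [mul_nonneg (sub_nonneg.2 ha2) (sq_nonneg t), mul_nonneg ht0.le (sub_nonneg.2 ht2)]
      have h2 : 4 ≤ C * P * ((b - 2 * a) / 2 * t) := by
        have : C * P * ((b - 2 * a) / 2 * t) = C * (b - 2 * a) / 2 * (P * t) := by ring
        rw [this]; nlinarith
      have h3 : 0 ≤ C * P := mul_nonneg hC0 hP0
      have h4 := mul_le_mul_of_nonneg_right h1 h3
      have h5 := mul_le_mul_of_nonneg_left hbern hC0
      nlinarith
  refine ⟨C, fun n hn => ?_⟩
  rcases le_total n n1 with h | h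
  · exact small n hn h
  · exact large n h

/-! ### The walk, the row noise and their measurability -/

namespace ERWInputs
variable {Ω : Type*}

lemma X_add_two (I : ERWInputs Ω) (n : ℕ) (ω : Ω) : I.X (n + 2) ω =
    I.coin (n + 1) ω * (if I.U (n + 1) ω < n + 2 then I.X (I.U (n + 1) ω) ω else 0) := by
  rw [X]; simp

/-- The position of the ERW with stops at time `n`. -/
def walk (I : ERWInputs Ω) (n : ℕ) (ω : Ω) : ℤ := ∑ j ∈ Finset.Icc 1 n, I.X j ω

/-- The fluctuation of the `n`-th row, up to its `k`-th step, around its mean given the original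
walk. -/
noncomputable def rowNoise (m : ℕ → ℕ) (I : ERWInputs Ω) (a : ℝ) (n k : ℕ) (ω : Ω) : ℝ :=
  ∑ i ∈ Finset.Ioc (m n) k, ((I.arrX n i ω : ℝ) - a * I.walk (m n) ω / m n)

/-- The information carried by the inputs whose labels lie in `S`. -/
abbrev sigma (m : ℕ → ℕ) (I : ERWInputs Ω) (S : Set (ERWLabel m)) : MeasurableSpace Ω :=
  ⨆ a ∈ S, MeasurableSpace.comap (I.family m a) inferInstance

section Measurability
variable {m : ℕ → ℕ} {I : ERWInputs Ω} {S : Set (ERWLabel m)}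

lemma measurable_family {a : ERWLabel m} (ha : a ∈ S) : Measurable[I.sigma m S] (I.family m a) :=
  measurable_iff_comap_le.2
    (le_iSup₂_of_le (f := fun a (_ : a ∈ S) => MeasurableSpace.comap (I.family m a) inferInstance)
      a ha le_rfl)

lemma measurable_of_family_eq_cast {a : ERWLabel m} (ha : a ∈ S) {V : Ω → ℕ}
    (hV : I.family m a = fun ω => (V ω : ℤ)) : Measurable[I.sigma m S] V := by
  have h : V = Int.toNat ∘ I.family m a := by rw [hV]; ext; simp
  rw [h]
  exact (measurable_of_countable Int.toNat).comp (measurable_family ha)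

lemma measurable_apply {F : MeasurableSpace Ω} {V : Ω → ℕ} {x : ℕ → Ω → ℤ} (hV : Measurable V)
    (hx : ∀ j, Measurable (x j)) : Measurable fun ω => x (V ω) ω := by
  have : Measurable fun z : Ω × ℕ => x z.2 z.1 := measurable_from_prod_countable_left hx
  exact this.comp (measurable_id.prodMk hV)

/-- X_{n+2} reads only the inputs of index n + 1 and earlier steps; the guard on the memory in `X`
makes strong induction suffice. -/
lemma measurable_X {N : ℕ} (h0 : .first ∈ S) (hU : ∀ n hn, n < N → .U n hn ∈ S)
    (hcoin : ∀ n hn, n < N → .coin n hn ∈ S) (j : ℕ) (hj : j ≤ N) :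
    Measurable[I.sigma m S] (I.X j) := by
  induction j using Nat.strong_induction_on with
  | _ j ih =>
    match j, hj, ih with
    | 0, _, _ =>
      have : I.X 0 = fun _ => 0 := by ext; rw [X]
      rw [this]; exact measurable_const
    | 1, _, _ =>
      have : I.X 1 = I.family m .first := by ext; rw [X]; rfl
      rw [this]; exact measurable_family h0
    | n + 2, hj, ih =>
      have hV : Measurable[I.sigma m S] (I.U (n + 1)) :=
        measurable_of_family_eq_cast (hU (n + 1) (by omega) (by omega)) rfl
      have hc : Measurable[I.sigma m S] (I.coin (n + 1)) :=
        measurable_family (hcoin (n + 1) (by omega) (by omega))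
      have h1 : I.X (n + 2) = fun ω => I.coin (n + 1) ω *
          (fun (i : ℕ) (ω : Ω) => if i < n + 2 then I.X i ω else 0) (I.U (n + 1) ω) ω := by
        ext ω; rw [X_add_two]
      rw [h1]
      refine hc.mul (measurable_apply hV (x := fun i ω => if i < n + 2 then I.X i ω else 0) fun i => ?_)
      by_cases hi : i < n + 2
      · simpa [hi] using ih i hi (by omega)
      · simp only [hi, if_false]; exact measurable_const

lemma measurable_walk {N : ℕ} (h0 : .first ∈ S) (hU : ∀ n hn, n < N → .U n hn ∈ S)
    (hcoin : ∀ n hn, n < N → .coin n hn ∈ S) : Measurable[I.sigma m S] (I.walk N) :=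
  Finset.measurable_fun_sum _ fun j hj => measurable_X h0 hU hcoin j (Finset.mem_Icc.1 hj).2

lemma measurable_rowNoise {n k : ℕ} (a : ℝ) (hk : k ≤ n) (h0 : .first ∈ S)
    (hU : ∀ n hn, .U n hn ∈ S) (hcoin : ∀ n hn, .coin n hn ∈ S)
    (harrU : ∀ i hi, i ≤ k → .arrU n i hi ∈ S) (harrCoin : ∀ i hi, i ≤ k → .arrCoin n i hi ∈ S) :
    Measurable[I.sigma m S] (I.rowNoise m a n k) := by
  have hX : ∀ j, Measurable[I.sigma m S] (I.X j) := fun j =>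
    measurable_X (N := j) h0 (fun n hn _ => hU n hn) (fun n hn _ => hcoin n hn) j le_rfl
  have hW : Measurable[I.sigma m S] (I.walk (m n)) :=
    measurable_walk h0 (fun n hn _ => hU n hn) (fun n hn _ => hcoin n hn)
  refine Finset.measurable_fun_sum _ fun i hi => ?_
  obtain ⟨h1, h2⟩ := Finset.mem_Ioc.1 hi
  have hV : Measurable[I.sigma m S] (I.arrU n i) :=
    measurable_of_family_eq_cast (harrU i ⟨h1, h2.trans hk⟩ h2) rfl
  have hc : Measurable[I.sigma m S] (I.arrCoin n i) :=
    measurable_family (harrCoin i ⟨h1, h2.trans hk⟩ h2)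
  have hY : Measurable[I.sigma m S] (I.arrX n i) := hc.mul (measurable_apply hV hX)
  exact ((measurable_of_countable (fun z : ℤ => (z : ℝ))).comp hY).sub
    ((measurable_of_countable (fun z : ℤ => a * (z : ℝ) / m n)).comp hW)

end Measurability

/-! ### Exponential moments and almost sure limits -/

namespace HasERWLaw
variable [mΩ : MeasurableSpace Ω] {μ : Measure Ω} {s p q r : ℝ}
  {m : ℕ → ℕ} {I : ERWInputs Ω}

lemma measurable_family (hI : I.HasERWLaw μ m s p q r) (a : ERWLabel m) :
    Measurable (I.family m a) := by
  cases a with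
  | first => exact hI.measurable_first
  | U n hn => exact (measurable_of_countable _).comp (hI.uniform_U n hn).measurable
  | coin n hn => exact (hI.coin_law n hn).measurable
  | arrU n k hk => exact (measurable_of_countable _).comp (hI.uniform_arrU n k hk.1 hk.2).measurable
  | arrCoin n k hk => exact (hI.arrCoin_law n k hk.1 hk.2).measurable

lemma sigma_le (hI : I.HasERWLaw μ m s p q r) (S : Set (ERWLabel m)) : I.sigma m S ≤ mΩ :=
  iSup₂_le fun a _ => (hI.measurable_family a).comap_le

variable [IsProbabilityMeasure μ]

lemma ae_abs_X_le (hI : I.HasERWLaw μ m s p q r) (hpqr : p + q + r = 1) :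
    ∀ᵐ ω ∂μ, ∀ j, |I.X j ω| ≤ 1 := by
  have h1 : ∀ᵐ ω ∂μ, I.first ω ∈ ({1, -1} : Finset ℤ) := by
    refine ae_mem_finset_of_sum_measureReal hI.measurable_first _ ?_
    simp [hI.first_one, hI.first_neg_one]
  have h2 : ∀ᵐ ω ∂μ, ∀ n, 1 ≤ n → I.coin n ω ∈ ({1, -1, 0} : Finset ℤ) := by
    rw [ae_all_iff]; intro n
    rw [eventually_imp_distrib_left]
    exact fun hn => (hI.coin_law n hn).ae_mem hpqr
  filter_upwards [h1, h2] with ω h1 h2 j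
  induction j using Nat.strong_induction_on with
  | _ j ih =>
    match j, ih with
    | 0, _ => rw [X]; simp
    | 1, _ =>
      rw [X]
      simp only [Finset.mem_insert, Finset.mem_singleton] at h1
      rcases h1 with h | h <;> simp [h]
    | n + 2, ih =>
      rw [X_add_two, abs_mul]
      refine mul_le_one₀ ?_ (abs_nonneg _) ?_
      · have := h2 (n + 1) (by omega)
        simp only [Finset.mem_insert, Finset.mem_singleton] at this
        rcases this with h | h | h <;> simp [h]
      · split_ifs with h
        · exact ih _ h
        · simp

/-- Disjoint sets of labels generate independent σ-algebras, so a fresh memory and coin are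
independent of the past carried by `S`. This serves both the walk and the rows. -/
lemma lintegral_mul_exp_le (hI : I.HasERWLaw μ m s p q r) (hpqr : p + q + r = 1) {N : ℕ}
    (hN : 1 ≤ N) {S : Set (ERWLabel m)} {a b : ERWLabel m} (hab : a ≠ b) (ha : a ∉ S) (hb : b ∉ S)
    {V : Ω → ℕ} {ε : Ω → ℤ} (hVa : I.family m a = fun ω => (V ω : ℤ)) (hεb : I.family m b = ε)
    (hV : IsUniformUpTo μ N V) (hε : IsStepCoin μ p q r ε) {x : ℕ → Ω → ℤ}
    (hx : ∀ j, Measurable[I.sigma m S] (x j)) (hxb : ∀ᵐ ω ∂μ, ∀ j, |x j ω| ≤ 1)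
    {g : Ω → ENNReal} (hg : Measurable[I.sigma m S] g) (l : ℝ) :
    ∫⁻ ω, g ω * ENNReal.ofReal (Real.exp (l * (ε ω * x (V ω) ω : ℤ))) ∂μ ≤
      ∫⁻ ω, g ω * ENNReal.ofReal (Real.exp
        (l * ((p - q) * (∑ j ∈ Finset.Icc 1 N, x j ω : ℤ) / N) + 4 * l ^ 2)) ∂μ := by
  have hVε : IndepFun V ε μ := by
    have h := (hI.indep.indepFun hab).comp (measurable_of_countable Int.toNat) measurable_id
    have h1 : V = Int.toNat ∘ I.family m a := by rw [hVa]; ext; simp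
    rw [h1, ← hεb]; exact h
  have hind : Indep (I.sigma m {a, b}) (I.sigma m S) μ := by
    refine indep_iSup_of_disjoint (fun i => (hI.measurable_family i).comap_le)
      ((iIndepFun_iff_iIndep ..).1 hI.indep) ?_
    rw [Set.disjoint_left]
    rintro c (rfl | rfl)
    exacts [ha, hb]
  exact lintegral_mul_exp_step_le hpqr hN hV hε hVε (hI.sigma_le _) (hI.sigma_le _) hind
    (measurable_of_family_eq_cast (by simp) hVa)
    (hεb ▸ ERWInputs.measurable_family (by simp)) hx hxb hg l

lemma lintegral_exp_walk_succ_le (hI : I.HasERWLaw μ m s p q r) (hpqr : p + q + r = 1) {n : ℕ}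
    (hn : 1 ≤ n) (l : ℝ) :
    ∫⁻ ω, ENNReal.ofReal (Real.exp (l * I.walk (n + 1) ω)) ∂μ ≤ ENNReal.ofReal (Real.exp (4 * l ^ 2))
      * ∫⁻ ω, ENNReal.ofReal (Real.exp (l * (1 + (p - q) / n) * I.walk n ω)) ∂μ := by
  let S : Set (ERWLabel m) := {c | match c with
    | .first => True
    | .U k _ => k < n
    | .coin k _ => k < n
    | .arrU _ _ _ => False
    | .arrCoin _ _ _ => False}
  have h0 : .first ∈ S := trivial
  have hU : ∀ k hk, k < n → .U k hk ∈ S := fun k _ h => h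
  have hcoin : ∀ k hk, k < n → .coin k hk ∈ S := fun k _ h => h
  have hg : Measurable[I.sigma m S] fun ω => ENNReal.ofReal (Real.exp (l * I.walk n ω)) :=
    (measurable_of_countable (fun z : ℤ => ENNReal.ofReal (Real.exp (l * z)))).comp
      (measurable_walk h0 hU hcoin)
  have hxb : ∀ᵐ ω ∂μ, ∀ j, |I.X (min j n) ω| ≤ 1 := by
    filter_upwards [hI.ae_abs_X_le hpqr] with ω hω j using hω _
  have key := hI.lintegral_mul_exp_le hpqr hn (S := S) (a := .U n hn) (b := .coin n hn) (ε := I.coin n) (by simp)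
    (lt_irrefl n) (lt_irrefl n) rfl rfl (hI.uniform_U n hn) (hI.coin_law n hn)
    -- Truncating at n makes every entry measurable with respect to the past; nothing changes almost
    -- surely, as U_n ≤ n.
    (x := fun j => I.X (min j n))
    (fun j => measurable_X h0 hU hcoin _ (min_le_right _ _)) hxb hg l
  calc _ = _ := lintegral_congr_ae ?_
    _ ≤ _ := key
    _ = ∫⁻ ω, ENNReal.ofReal (Real.exp (4 * l ^ 2)) *
      ENNReal.ofReal (Real.exp (l * (1 + (p - q) / n) * I.walk n ω)) ∂μ := lintegral_congr fun ω => ?_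
    _ = _ := lintegral_const_mul' _ _ ENNReal.ofReal_ne_top
  · filter_upwards [(hI.uniform_U n hn).ae_mem hn] with ω hω
    obtain ⟨k, rfl⟩ : ∃ k, n = k + 1 := ⟨n - 1, by omega⟩
    have hle := (Finset.mem_Icc.1 hω).2
    have h1 : I.walk (k + 1 + 1) ω = I.walk (k + 1) ω +
        I.coin (k + 1) ω * I.X (min (I.U (k + 1) ω) (k + 1)) ω := by
      rw [walk, Finset.sum_Icc_succ_top (by omega), ← walk, X_add_two, if_pos (by omega),
        min_eq_left hle]
    simp only [h1]
    rw [← ENNReal.ofReal_mul (Real.exp_nonneg _), ← Real.exp_add, Int.cast_add, mul_add]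
  · have h2 : ∑ j ∈ Finset.Icc 1 n, I.X (min j n) ω = I.walk n ω :=
      Finset.sum_congr rfl fun j hj => by rw [min_eq_left (Finset.mem_Icc.1 hj).2]
    rw [h2, ← ENNReal.ofReal_mul (Real.exp_nonneg _), ← ENNReal.ofReal_mul (Real.exp_nonneg _),
      ← Real.exp_add, ← Real.exp_add]
    congr 2; ring

lemma exists_lintegral_exp_walk_le (hI : I.HasERWLaw μ m s p q r) (hpqr : p + q + r = 1) {b : ℝ}
    (ha : |p - q| ≤ 1) (hb : 1 < b) (hab : 2 * (p - q) < b) :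
    ∃ C : ℝ, ∀ n, 1 ≤ n → ∀ l : ℝ, ∫⁻ ω, ENNReal.ofReal (Real.exp (l * I.walk n ω)) ∂μ ≤
      ENNReal.ofReal (Real.exp (1 + C * (n : ℝ) ^ b * l ^ 2)) := by
  let v : ℕ → ℝ := fun n => Nat.rec 1 (fun n w => (1 + (p - q) / n) ^ 2 * w + 4) n
  have hvs : ∀ n : ℕ, v (n + 1) = (1 + (p - q) / n) ^ 2 * v n + 4 := fun n => rfl
  have hwalk : ∀ n, 1 ≤ n → ∀ l : ℝ, ∫⁻ ω, ENNReal.ofReal (Real.exp (l * I.walk n ω)) ∂μ ≤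
      ENNReal.ofReal (Real.exp (1 + v n * l ^ 2)) := by
    intro n hn
    induction n, hn using Nat.le_induction with
    | base =>
      intro l
      -- The recursion from index 0 uses a / 0 = 0.
      have hv1 : v 1 = 5 := by rw [← zero_add 1, hvs]; simp [v]; norm_num
      calc _ ≤ ∫⁻ _, ENNReal.ofReal (Real.exp (1 + v 1 * l ^ 2)) ∂μ := lintegral_mono_ae ?_
        _ = _ := by simp
      filter_upwards [hI.ae_abs_X_le hpqr] with ω hω
      refine ENNReal.ofReal_le_ofReal (Real.exp_le_exp.2 ?_)
      have h1 : |(I.walk 1 ω : ℝ)| ≤ 1 := by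
        rw [walk, Finset.Icc_self, Finset.sum_singleton]
        exact_mod_cast hω 1
      have h2 := abs_le.1 h1
      rw [hv1]
      -- X_1 need not be centred; the additive 1 in the exponent absorbs its linear term.
      nlinarith [sq_nonneg (l - I.walk 1 ω), sq_nonneg l]
    | succ n hn ih =>
      intro l
      refine (hI.lintegral_exp_walk_succ_le hpqr hn l).trans ?_
      refine (mul_le_mul_right (ih _) _).trans ?_
      rw [← ENNReal.ofReal_mul (Real.exp_nonneg _), ← Real.exp_add, hvs]
      refine ENNReal.ofReal_le_ofReal (Real.exp_le_exp.2 (le_of_eq ?_))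
      ring
  obtain ⟨C, hC⟩ := exists_forall_le_mul_rpow ha hb hab fun n _ => (hvs n).le
  refine ⟨C, fun n hn l => (hwalk n hn l).trans ?_⟩
  have := hC n hn
  gcongr

lemma lintegral_exp_rowNoise_le (hI : I.HasERWLaw μ m s p q r) (hpqr : p + q + r = 1) {n : ℕ}
    (hm : 1 ≤ m n) (l : ℝ) (k : ℕ) (hmk : m n ≤ k) (hk : k ≤ n) :
    ∫⁻ ω, ENNReal.ofReal (Real.exp (l * I.rowNoise m (p - q) n k ω)) ∂μ ≤
      ENNReal.ofReal (Real.exp (4 * k * l ^ 2)) := by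
  induction k, hmk using Nat.le_induction with
  | base =>
    simp only [rowNoise, Finset.Ioc_self, Finset.sum_empty, mul_zero, Real.exp_zero, lintegral_const,
      measure_univ, mul_one]
    exact ENNReal.ofReal_le_ofReal (Real.one_le_exp (by positivity))
  | succ k hmk ih =>
    -- The past contains the whole original walk, so the drift of the row is already known.
    let S : Set (ERWLabel m) := {c | match c with
      | .first => True
      | .U _ _ => True
      | .coin _ _ => True
      | .arrU _ i _ => i ≤ k
      | .arrCoin _ i _ => i ≤ k}
    have h0 : .first ∈ S := trivial
    have hU : ∀ j hj, .U j hj ∈ S := fun _ _ => trivial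
    have hcoin : ∀ j hj, .coin j hj ∈ S := fun _ _ => trivial
    have hX : ∀ j, Measurable[I.sigma m S] (I.X j) := fun j =>
      measurable_X (N := j) h0 (fun n hn _ => hU n hn) (fun n hn _ => hcoin n hn) j le_rfl
    have hW : Measurable[I.sigma m S] (I.walk (m n)) :=
      measurable_walk h0 (fun n hn _ => hU n hn) (fun n hn _ => hcoin n hn)
    have hR : Measurable[I.sigma m S] (I.rowNoise m (p - q) n k) :=
      measurable_rowNoise _ (by omega) h0 hU hcoin (fun i _ hi => hi) (fun i _ hi => hi)
    let drift : Ω → ℝ := fun ω => (p - q) * I.walk (m n) ω / m n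
    have hdrift : Measurable[I.sigma m S] drift :=
      (measurable_of_countable (fun z : ℤ => (p - q) * (z : ℝ) / m n)).comp hW
    -- Subtracting the drift in the weight cancels the conditional mean of the next step.
    have hg : Measurable[I.sigma m S] fun ω =>
        ENNReal.ofReal (Real.exp (l * (I.rowNoise m (p - q) n k ω - drift ω))) :=
      ENNReal.measurable_ofReal.comp (Real.measurable_exp.comp ((hR.sub hdrift).const_mul l))
    have hlab : m n < k + 1 ∧ k + 1 ≤ n := ⟨by omega, hk⟩
    have key := hI.lintegral_mul_exp_le hpqr hm (S := S) (a := .arrU n (k + 1) hlab)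
      (b := .arrCoin n (k + 1) hlab) (ε := I.arrCoin n (k + 1)) (by simp) (Nat.not_succ_le_self k)
      (Nat.not_succ_le_self k) rfl rfl (hI.uniform_arrU n (k + 1) hlab.1 hlab.2) (hI.arrCoin_law n (k + 1) hlab.1 hlab.2)
      hX (hI.ae_abs_X_le hpqr) hg l
    calc _ = _ := lintegral_congr fun ω => ?_
      _ ≤ _ := key
      _ = ∫⁻ ω, ENNReal.ofReal (Real.exp (4 * l ^ 2)) *
        ENNReal.ofReal (Real.exp (l * I.rowNoise m (p - q) n k ω)) ∂μ := lintegral_congr fun ω => ?_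
      _ = _ := lintegral_const_mul' _ _ ENNReal.ofReal_ne_top
      _ ≤ _ := mul_le_mul_right (ih (by omega)) _
      _ = _ := ?_
    · have h1 : I.rowNoise m (p - q) n (k + 1) ω =
          I.rowNoise m (p - q) n k ω + (I.arrX n (k + 1) ω - drift ω) := by
        rw [rowNoise, Finset.sum_Ioc_succ_top hmk]; rfl
      rw [h1, ← ENNReal.ofReal_mul (Real.exp_nonneg _), ← Real.exp_add, arrX]
      congr 2; ring
    · rw [← ENNReal.ofReal_mul (Real.exp_nonneg _), ← ENNReal.ofReal_mul (Real.exp_nonneg _),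
        ← Real.exp_add, ← Real.exp_add]
      congr 2
      simp only [drift, walk]; ring
    · rw [← ENNReal.ofReal_mul (Real.exp_nonneg _), ← Real.exp_add]
      congr 2
      push_cast; ring

lemma ae_tendsto_walk_div_rpow (hI : I.HasERWLaw μ m s p q r) (hpqr : p + q + r = 1)
    (ha : |p - q| ≤ 1) {c : ℝ} (hc : 1 / 2 < c) (hac : p - q < c) :
    ∀ᵐ ω ∂μ, Tendsto (fun n : ℕ => (I.walk n ω : ℝ) / (n : ℝ) ^ c) atTop (𝓝 0) := by
  obtain ⟨b, hb, hbc⟩ := exists_between (show max 1 (2 * (p - q)) < 2 * c from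
    max_lt (by linarith) (by linarith))
  obtain ⟨hb1, hb2⟩ := max_lt_iff.1 hb
  obtain ⟨C, hC⟩ := hI.exists_lintegral_exp_walk_le hpqr ha hb1 hb2
  refine ae_tendsto_div_rpow_of_lintegral_exp_le (fun n => ?_) hbc hC
  exact (measurable_of_countable (fun z : ℤ => (z : ℝ))).comp
    ((measurable_walk (S := Set.univ) (by simp) (by simp) (by simp)).mono (hI.sigma_le _) le_rfl)

lemma ae_tendsto_rowNoise_div_rpow (hI : I.HasERWLaw μ m s p q r) (hpqr : p + q + r = 1)
    (hm : ∀ n, 1 ≤ n → 1 ≤ m n ∧ m n ≤ n) {c : ℝ} (hc : 1 / 2 < c) :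
    ∀ᵐ ω ∂μ, Tendsto (fun n : ℕ => I.rowNoise m (p - q) n n ω / (n : ℝ) ^ c) atTop (𝓝 0) := by
  refine ae_tendsto_div_rpow_of_lintegral_exp_le (C := 4) (b := 1) (fun n => ?_) (by linarith)
    fun n hn l => ?_
  · exact (measurable_rowNoise (S := Set.univ) _ le_rfl (by simp) (by simp) (by simp) (by simp)
      (by simp)).mono (hI.sigma_le _) le_rfl
  · refine (hI.lintegral_exp_rowNoise_le hpqr (hm n hn).1 l n (hm n hn).2 le_rfl).trans ?_
    rw [Real.rpow_one]
    exact ENNReal.ofReal_le_ofReal (Real.exp_le_exp.2 (by linarith))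

end HasERWLaw

/-! ### Decomposition of T_n and conclusion -/

lemma T_eq (m : ℕ → ℕ) (I : ERWInputs Ω) (a : ℝ) {n : ℕ} (hm : 1 ≤ m n ∧ m n ≤ n) (ω : Ω) :
    (I.T m n ω : ℝ) = I.walk (m n) ω + (n - m n : ℝ) * (a * I.walk (m n) ω / m n) +
      I.rowNoise m a n n ω := by
  have h1 : I.T m n ω = I.walk (m n) ω + ∑ i ∈ Finset.Ioc (m n) n, I.arrX n i ω := by
    have hd : Finset.Icc 1 n = Finset.Icc 1 (m n) ∪ Finset.Ioc (m n) n := by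
      ext i; simp only [Finset.mem_union, Finset.mem_Icc, Finset.mem_Ioc]; omega
    rw [T, S, hd, Finset.sum_union]
    · congr 1
      · exact Finset.sum_congr rfl fun i hi => if_pos (Finset.mem_Icc.1 hi).2
      · exact Finset.sum_congr rfl fun i hi => if_neg (by have := Finset.mem_Ioc.1 hi; omega)
    · rw [Finset.disjoint_left]
      intro i h1 h2
      have := Finset.mem_Icc.1 h1
      have := Finset.mem_Ioc.1 h2
      omega
  rw [h1, rowNoise, Finset.sum_sub_distrib, Finset.sum_const, Nat.card_Ioc, nsmul_eq_mul,
    Nat.cast_sub hm.2]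
  push_cast; ring

end ERWInputs

/-- The deterministic comparison of the array with the original walk and with the noise. -/
lemma abs_ratio_mul_div_rpow_le {a c M n W R : ℝ} (ha : |a| ≤ 1) (hc : c ≤ 1) (hM : 1 ≤ M)
    (hMn : M ≤ n) : |M / n * (W + (n - M) * (a * W / M) + R) / M ^ c| ≤
      |W / M ^ c| + |R / n ^ c| := by
  have hM0 : 0 < M := by linarith
  have hn0 : 0 < n := by linarith
  have hMc : 0 < M ^ c := Real.rpow_pos_of_pos hM0 c
  have hnc : 0 < n ^ c := Real.rpow_pos_of_pos hn0 c
  -- The coefficient of W / M^c is a convex combination of 1 and a, hence at most 1 in absolute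
  -- value.
  have h1 : M / n * (W + (n - M) * (a * W / M) + R) / M ^ c =
      (M / n + a * (1 - M / n)) * (W / M ^ c) + M / n * R / M ^ c := by
    field_simp
  rw [h1]
  have ht : M / n ≤ 1 := (div_le_one hn0).2 hMn
  have ht0 : 0 ≤ M / n := by positivity
  refine (abs_add_le _ _).trans (add_le_add ?_ ?_)
  · rw [abs_mul]
    refine mul_le_of_le_one_left (abs_nonneg _) (abs_le.2 ?_)
    have := abs_le.1 ha
    constructor <;> nlinarith
  · rw [abs_div, abs_mul, abs_of_nonneg ht0, abs_div, abs_of_pos hMc, abs_of_pos hnc,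
      div_le_div_iff₀ hMc hnc]
    -- This is M / n ≤ (M / n)^c, where c ≤ 1 enters.
    have h2 : M / n * n ^ c ≤ M ^ c := by
      have h3 : M * n ^ c / n ≤ M ^ c := by
        have e1 : n ^ c / n = n ^ (c - 1) := (Real.rpow_sub_one hn0.ne' c).symm
        have e2 : M ^ c / M = M ^ (c - 1) := (Real.rpow_sub_one hM0.ne' c).symm
        have h4 : n ^ (c - 1) ≤ M ^ (c - 1) := Real.rpow_le_rpow_of_nonpos hM0 hMn (by linarith)
        rw [← e1, ← e2, le_div_iff₀ hM0] at h4
        calc _ = n ^ c / n * M := by ring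
          _ ≤ _ := h4
      calc _ = M * n ^ c / n := by ring
        _ ≤ _ := h3
    calc M / n * |R| * n ^ c = |R| * (M / n * n ^ c) := by ring
      _ ≤ |R| * M ^ c := by gcongr

theorem theorem5p3 {Ω : Type*} [MeasurableSpace Ω] (μ : Measure Ω) [IsProbabilityMeasure μ]
    (s p q r α β γ : ℝ) (m : ℕ → ℕ) (I : ERWInputs Ω)
    (hs : s ∈ Set.Icc (0 : ℝ) 1)
    (hp : p ∈ Set.Ico (0 : ℝ) 1) (hq : q ∈ Set.Ico (0 : ℝ) 1) (hr : r ∈ Set.Ioo (0 : ℝ) 1)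
    (hpqr : p + q + r = 1)
    (hα : α = p - q) (hβ : β = 1 - r)
    (hβ_mem : β ∈ Set.Ioo (0 : ℝ) 1) (hα_mem : α ∈ Set.Icc (-β) β)
    (hm : ∀ n, 1 ≤ n → 1 ≤ m n ∧ m n ≤ n)
    (hm_lim : Tendsto m atTop atTop)
    (hγ : γ ∈ Set.Icc (0 : ℝ) 1)
    (hγ_lim : Tendsto (fun n : ℕ => (m n : ℝ) / (n : ℝ)) atTop (𝓝 γ))
    (hI : I.HasERWLaw μ m s p q r) :
    (∀ᵐ ω ∂μ, Tendsto (fun n : ℕ => (I.T m n ω : ℝ) / (n : ℝ)) atTop (𝓝 0)) ∧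
    ∀ c ∈ Set.Ioo (max α (1 / 2)) 1,
      ∀ᵐ ω ∂μ, Tendsto
        (fun n : ℕ => ((m n : ℝ) / (n : ℝ)) * (I.T m n ω : ℝ) / (m n : ℝ) ^ c) atTop (𝓝 0) := by
  have hα1 : |p - q| ≤ 1 := by
    rw [← hα, abs_le]; constructor <;> linarith [hα_mem.1, hα_mem.2, hβ_mem.2]
  have second : ∀ c ∈ Set.Ioo (max α (1 / 2)) 1, ∀ᵐ ω ∂μ, Tendsto
      (fun n : ℕ => ((m n : ℝ) / (n : ℝ)) * (I.T m n ω : ℝ) / (m n : ℝ) ^ c) atTop (𝓝 0) := by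
    rintro c ⟨hc, hc1⟩
    obtain ⟨hac, hc⟩ := max_lt_iff.1 hc
    filter_upwards [hI.ae_tendsto_walk_div_rpow hpqr hα1 hc (hα ▸ hac),
      hI.ae_tendsto_rowNoise_div_rpow hpqr hm hc] with ω h1 h2
    have h3 := (h1.comp hm_lim).abs.add h2.abs
    rw [abs_zero, add_zero] at h3
    refine squeeze_zero_norm' ?_ h3
    filter_upwards [eventually_ge_atTop 1] with n hn
    rw [ERWInputs.T_eq m I (p - q) (hm n hn), Real.norm_eq_abs]
    exact abs_ratio_mul_div_rpow_le hα1 hc1.le (by exact_mod_cast (hm n hn).1)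
      (by exact_mod_cast (hm n hn).2)
  refine ⟨?_, second⟩
  obtain ⟨c, hc⟩ := exists_between (show max α (1 / 2) < 1 from
    max_lt (by linarith [hα_mem.2, hβ_mem.2]) (by norm_num))
  filter_upwards [second c hc] with ω hω
  refine squeeze_zero_norm' ?_ (by simpa using hω.abs)
  filter_upwards [eventually_ge_atTop 1] with n hn
  have hM : (1 : ℝ) ≤ m n := by exact_mod_cast (hm n hn).1
  have hM0 : (0 : ℝ) < m n := by linarith
  have hMc : 0 < (m n : ℝ) ^ c := Real.rpow_pos_of_pos hM0 c
  have hle : (m n : ℝ) ^ c ≤ m n := by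
    simpa using Real.rpow_le_rpow_of_exponent_le hM hc.2.le
  rw [Real.norm_eq_abs]
  -- The factor m_n^(1-c) is at least 1, so T_n / n is dominated by the sequence of the second
  -- claim.
  have heq : (m n : ℝ) / n * (I.T m n ω : ℝ) / (m n : ℝ) ^ c =
      (m n : ℝ) / (m n : ℝ) ^ c * ((I.T m n ω : ℝ) / n) := by ring
  rw [heq, abs_mul]
  refine le_mul_of_one_le_left (abs_nonneg _) ?_
  rw [abs_of_pos (by positivity)]
  exact (one_le_div hMc).2 hle
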